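/- Let $n$, $b$ and $a_i,u_i$ ($i\in N:=\{1,\dots,n\}$) be positive integers such that $\{(a_i,u_i)\}_{i\in N}$ is weakly superincreasing, i.e. $\sum_{k=1}^{i}a_ku_k\le a_{i+1}$ for all $1\le i<n$, and let $K=\{x\in\mathbb{Z}^n:\ \sum_{i\in N}a_ix_i\le b,\ 0\le x_i\le u_i\ \forall i\in N\}$. Let $\theta$ be the greedy solution of $K$, defined recursively for $i=n,n-1,\dots,1$ by $$\theta_i=\min\Big\{u_i,\Big\lfloor\frac{b-\sum_{k=i+1}^{n}a_k\theta_k}{a_i}\Big\rfloor\Big\}.$$ Put $I=\{i\in N:\theta_i\ge 1\}$, $I_j=\{i\in I: i>j\}$ for $j\in N$, and $$\phi_j(i)=(u_j-\theta_j)\prod_{k\in I,\ j<k<i}(u_k+1-\theta_k)\qquad (j\in N,\ i\in I_j),$$ where an empty product equals $1$. Then $$\operatorname{conv}(K)=\Big\{x\in\mathbb{R}^n:\ 0\le x_i\le u_i\ \forall i\in N,\quad x_j+\sum_{i\in I_j}\phi_j(i)(x_i-\theta_i)\le\theta_j\ \ \forall j\in N\Big\}.$$ In particular, $\operatorname{conv}(K)$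 is the solution set of a system of $3n$ linear inequalities. -/

import Mathlib

namespace SuperincreasingKnapsack

variable {n : ℕ}

/-- The bounded integer knapsack `{x ∈ ℤⁿ : 0 ≤ x ≤ u, aᵀx ≤ b}`. -/
def knapsack (a u : Fin n → ℤ) (b : ℤ) : Set (Fin n → ℤ) :=
  {x | (∀ i, 0 ≤ x i ∧ x i ≤ u i) ∧ ∑ i, a i * x i ≤ b}

/-- The convex hull in `ℝⁿ` of the knapsack. -/
def knapsackPolytope (a u : Fin n → ℤ) (b : ℤ) : Set (Fin n → ℝ) :=
  convexHull ℝ ((fun (x : Fin n → ℤ) (i : Fin n) => (x i : ℝ)) '' knapsack a u b)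

/-- The tuples `(a i, u i)` form a weakly superincreasing sequence:
`a 1 * u 1 + ... + a i * u i ≤ a (i + 1)` for all `i` such that `i + 1` is an index. -/
def WeaklySuperincreasing (a u : Fin n → ℤ) : Prop :=
  ∀ i j : Fin n, (j : ℕ) = (i : ℕ) + 1 → ∑ k ∈ Finset.Iic i, a k * u k ≤ a j

/-- The greedy solution, computed from the last index down to the first:
`θ i = min (u i) ⌊(b - ∑_{k > i} a k * θ k) / a i⌋`.
(Integer division by a positive integer is the floor of the quotient.) -/
def greedy (a u : Fin n → ℤ) (b : ℤ) (i : Fin n) : ℤ :=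
  min (u i) ((b - ∑ k ∈ (Finset.Ioi i).attach, a k.1 * greedy a u b k.1) / a i)
termination_by n - (i : ℕ)
decreasing_by
  have h : i < k.1 := Finset.mem_Ioi.mp k.2
  have h' : (i : ℕ) < (k.1 : ℕ) := h
  have := k.1.isLt
  omega

/-- The defining recursion of the greedy solution, without the bookkeeping for termination. -/
theorem greedy_eq (a u : Fin n → ℤ) (b : ℤ) (i : Fin n) :
    greedy a u b i =
      min (u i) ((b - ∑ k ∈ Finset.Ioi i, a k * greedy a u b k) / a i) := by
  rw [greedy, Finset.sum_attach (Finset.Ioi i) (fun k => a k * greedy a u b k)]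

/-- The support `I = {i : θ i ≥ 1}`. -/
def support (θ : Fin n → ℤ) : Finset (Fin n) :=
  Finset.univ.filter fun i => 1 ≤ θ i

/-- The part `I_j = {i ∈ I : i > j}` of the support above `j`. -/
def supportAbove (θ : Fin n → ℤ) (j : Fin n) : Finset (Fin n) :=
  (support θ).filter fun i => j < i

/-- The coefficient `φ_j(i) = (u j - θ j) * ∏ (u k + 1 - θ k)`, the product being over the
elements `k` of the support from the one following `j` to the one preceding `i`. -/
def phi (u θ : Fin n → ℤ) (j i : Fin n) : ℤ :=
  (u j - θ j) * ∏ k ∈ (support θ).filter (fun k => j < k ∧ k < i), (u k + 1 - θ k)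

end SuperincreasingKnapsack

namespace SuperincreasingKnapsack

/-! Compare vectors lexicographically from the last index down. Superincreasingness makes the
integer points of `K` exactly the box points that are at most `θ`: lowering coordinate `j` by one
frees `a j`, which pays for everything below.

With `T_m` for `tail` and `E_j` for `excess`, the inequalities say `E_j ≤ 0`, where `E_j = x_j - θ_j
+ (u_j - θ_j) T_{j+1}`, and `T_j = T_{j+1} + E_j` on the support, `T_j = T_{j+1}` off it. For a
knapsack point the first departure from `θ` gives `T ≤ -1`, which persists downward and forces `E_j
≤ x_j - u_j ≤ 0`.

Conversely, let `x` satisfy the system and agree with `θ` above `m`. If `x_m ≤ θ_m - 1`, then `x`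
lies in an integral box inside `K`. If `θ_m - 1 < x_m < θ_m`, then `x` is a convex combination of
such a point and a point of the system agreeing with `θ` from `m` on
(`exists_decomposition_of_mem_packing`); induction on `m` finishes. -/

/-- Downward induction along the indices `n, n - 1, …, 0`. -/
theorem downward_induction {p : ℕ → Prop} (hn : p n) (h : ∀ j : Fin n, p (j + 1) → p j) :
    ∀ m ≤ n, p m := fun _ hm =>
  Nat.decreasingInduction (motive := fun k _ => p k) (fun k hk ih => h ⟨k, hk⟩ ih) hn hm

/-! ### The greedy solution and the lexicographic order -/

theorem sum_le_filter_insert (f : Fin n → ℤ) (j : Fin n) :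
    ∑ k ∈ Finset.univ.filter (fun k : Fin n => (j : ℕ) ≤ k), f k =
      f j + ∑ k ∈ Finset.Ioi j, f k := by
  have h : Finset.univ.filter (fun k : Fin n => (j : ℕ) ≤ k) = insert j (Finset.Ioi j) := by
    ext k
    simp only [Finset.mem_filter, Finset.mem_univ, true_and, Finset.mem_insert, Finset.mem_Ioi,
      Fin.lt_def, Fin.ext_iff]
    omega
  rw [h, Finset.sum_insert (by simp)]

theorem filter_succ_le_eq_Ioi (j : Fin n) :
    Finset.univ.filter (fun k : Fin n => (j : ℕ) + 1 ≤ k) = Finset.Ioi j := by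
  ext k
  simp only [Finset.mem_filter, Finset.mem_univ, true_and, Finset.mem_Ioi, Fin.lt_def]
  omega

theorem sum_greedy_tail_le (a u : Fin n → ℤ) (b : ℤ) (ha : ∀ i, 0 < a i) (hb : 0 < b) :
    ∀ m ≤ n, ∑ k ∈ Finset.univ.filter (fun k : Fin n => m ≤ k), a k * greedy a u b k ≤ b := by
  apply downward_induction
  · rw [Finset.filter_false_of_mem (fun k _ => by have := k.isLt; omega)]
    simpa using hb.le
  · intro j hj
    rw [filter_succ_le_eq_Ioi] at hj
    rw [sum_le_filter_insert]
    have h1 : greedy a u b j ≤ (b - ∑ k ∈ Finset.Ioi j, a k * greedy a u b k) / a j := by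
      conv_lhs => rw [greedy_eq]
      exact min_le_right _ _
    have h2 := mul_le_mul_of_nonneg_left h1 (ha j).le
    have h3 := Int.mul_ediv_self_le
      (x := b - ∑ k ∈ Finset.Ioi j, a k * greedy a u b k) (ha j).ne'
    linarith

theorem sum_greedy_Ioi_le (a u : Fin n → ℤ) (b : ℤ) (ha : ∀ i, 0 < a i) (hb : 0 < b)
    (j : Fin n) : ∑ k ∈ Finset.Ioi j, a k * greedy a u b k ≤ b := by
  rw [← filter_succ_le_eq_Ioi]
  exact sum_greedy_tail_le a u b ha hb _ j.isLt

theorem greedy_nonneg (a u : Fin n → ℤ) (b : ℤ) (ha : ∀ i, 0 < a i) (hu : ∀ i, 0 < u i)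
    (hb : 0 < b) (j : Fin n) : 0 ≤ greedy a u b j := by
  rw [greedy_eq]
  exact le_min (hu j).le
    (Int.ediv_nonneg (by linarith [sum_greedy_Ioi_le a u b ha hb j]) (ha j).le)

theorem greedy_le (a u : Fin n → ℤ) (b : ℤ) (j : Fin n) : greedy a u b j ≤ u j := by
  rw [greedy_eq]
  exact min_le_left _ _

theorem greedy_mem_knapsack (a u : Fin n → ℤ) (b : ℤ) (ha : ∀ i, 0 < a i)
    (hu : ∀ i, 0 < u i) (hb : 0 < b) : greedy a u b ∈ knapsack a u b :=
  ⟨fun i => ⟨greedy_nonneg a u b ha hu hb i, greedy_le a u b i⟩, by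
    simpa using sum_greedy_tail_le a u b ha hb 0 (Nat.zero_le n)⟩

/-- A point of the knapsack is lexicographically at most the greedy solution. -/
theorem le_greedy_of_eq_above {a u : Fin n → ℤ} {b : ℤ} (ha : ∀ i, 0 < a i)
    {x : Fin n → ℤ} (hx : x ∈ knapsack a u b) {j : Fin n}
    (h : ∀ i, j < i → x i = greedy a u b i) : x j ≤ greedy a u b j := by
  rw [greedy_eq]
  refine le_min (hx.1 j).2 ((Int.le_ediv_iff_mul_le (ha j)).2 ?_)
  have h1 : ∑ k ∈ Finset.univ.filter (fun k : Fin n => (j : ℕ) ≤ k), a k * x k ≤ b :=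
    (Finset.sum_le_univ_sum_of_nonneg
      fun k => mul_nonneg (ha k).le (hx.1 k).1).trans hx.2
  rw [sum_le_filter_insert] at h1
  have h2 : ∑ k ∈ Finset.Ioi j, a k * x k = ∑ k ∈ Finset.Ioi j, a k * greedy a u b k :=
    Finset.sum_congr rfl fun k hk => by rw [h k (Finset.mem_Ioi.1 hk)]
  linarith [mul_comm (x j) (a j)]

theorem WeaklySuperincreasing.sum_Iio_le {a u : Fin n → ℤ} (h : WeaklySuperincreasing a u)
    (ha : ∀ i, 0 < a i) (j : Fin n) : ∑ k ∈ Finset.Iio j, a k * u k ≤ a j := by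
  -- The hypothesis speaks only of indices with a predecessor; at the lowest index the sum is empty.
  rcases Nat.eq_zero_or_pos (j : ℕ) with hj | hj
  · have : Finset.Iio j = ∅ := by
      ext k
      simp only [Finset.mem_Iio, Fin.lt_def, Finset.notMem_empty, iff_false]
      omega
    rw [this]
    simpa using (ha j).le
  · have hlt : (j : ℕ) - 1 < n := by omega
    have : Finset.Iio j = Finset.Iic ⟨(j : ℕ) - 1, hlt⟩ := by
      ext k
      simp only [Finset.mem_Iio, Finset.mem_Iic, Fin.lt_def, Fin.le_def]
      omega
    rw [this]
    exact h _ _ (by simp only []; omega)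

/-- A point of the box lexicographically below the greedy solution lies in the knapsack. -/
theorem mem_knapsack_of_lt_greedy {a u : Fin n → ℤ} {b : ℤ} (ha : ∀ i, 0 < a i) (hb : 0 < b)
    (hsup : WeaklySuperincreasing a u) {x : Fin n → ℤ} (hx : ∀ i, 0 ≤ x i ∧ x i ≤ u i)
    {j : Fin n} (h : ∀ i, j < i → x i = greedy a u b i) (hj : x j ≤ greedy a u b j - 1) :
    x ∈ knapsack a u b := by
  refine ⟨hx, ?_⟩
  have h0 : (Finset.univ.filter fun k : Fin n => ¬ (j : ℕ) ≤ k) = Finset.Iio j := by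
    ext k
    simp only [Finset.mem_filter, Finset.mem_univ, true_and, Finset.mem_Iio, Fin.lt_def]
    omega
  rw [← Finset.sum_filter_add_sum_filter_not Finset.univ (fun k : Fin n => (j : ℕ) ≤ k), h0,
    sum_le_filter_insert]
  have h1 : ∑ k ∈ Finset.Iio j, a k * x k ≤ ∑ k ∈ Finset.Iio j, a k * u k :=
    Finset.sum_le_sum fun k _ => mul_le_mul_of_nonneg_left (hx k).2 (ha k).le
  have h2 : ∑ k ∈ Finset.Ioi j, a k * x k = ∑ k ∈ Finset.Ioi j, a k * greedy a u b k :=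
    Finset.sum_congr rfl fun k hk => by rw [h k (Finset.mem_Ioi.1 hk)]
  have h3 := sum_greedy_tail_le a u b ha hb j j.isLt.le
  rw [sum_le_filter_insert] at h3
  have h4 := hsup.sum_Iio_le ha j
  have h5 := mul_le_mul_of_nonneg_left hj (ha j).le
  linarith

/-! ### Weighted tails and their recursion -/

/-- The weighted deviation of `x` from `θ` on the part of the support from `m` on. -/
noncomputable def tail (u θ : Fin n → ℤ) (m : ℕ) (x : Fin n → ℝ) : ℝ :=
  ∑ i ∈ Finset.univ.filter (fun i : Fin n => 1 ≤ θ i ∧ m ≤ i),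
    (∏ k ∈ Finset.univ.filter (fun k : Fin n => 1 ≤ θ k ∧ m ≤ k ∧ k < i),
      ((u k : ℝ) + 1 - θ k)) * (x i - θ i)

/-- The amount by which `x` violates the inequality with index `j`. -/
noncomputable def excess (u θ : Fin n → ℤ) (j : Fin n) (x : Fin n → ℝ) : ℝ :=
  x j - θ j + ((u j : ℝ) - θ j) * tail u θ (j + 1) x

/-- Every weight above `j` contains the factor `(u j - θ j) + 1`: its first summand goes into the
excess, its second leaves the next tail. -/
theorem tail_of_support {u θ : Fin n → ℤ} {j : Fin n} (hj : 1 ≤ θ j) (x : Fin n → ℝ) :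
    tail u θ j x = excess u θ j x + tail u θ (j + 1) x := by
  have h : Finset.univ.filter (fun i : Fin n => 1 ≤ θ i ∧ (j : ℕ) ≤ i) =
      insert j (Finset.univ.filter (fun i : Fin n => 1 ≤ θ i ∧ (j : ℕ) + 1 ≤ i)) := by
    ext k
    simp only [Finset.mem_filter, Finset.mem_univ, true_and, Finset.mem_insert]
    by_cases hk : k = j
    · subst hk; simp [hj]
    · have : (k : ℕ) ≠ j := fun e => hk (Fin.ext e)
      simp only [hk, false_or]
      constructor <;> rintro ⟨h1, h2⟩ <;> exact ⟨h1, by omega⟩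
  have h0 : Finset.univ.filter (fun k : Fin n => 1 ≤ θ k ∧ (j : ℕ) ≤ k ∧ k < j) = ∅ := by
    ext k
    simp only [Finset.mem_filter, Finset.mem_univ, true_and, Fin.lt_def, Finset.notMem_empty,
      iff_false]
    omega
  have h1 : ∑ i ∈ Finset.univ.filter (fun i : Fin n => 1 ≤ θ i ∧ (j : ℕ) + 1 ≤ i),
      (∏ k ∈ Finset.univ.filter (fun k : Fin n => 1 ≤ θ k ∧ (j : ℕ) ≤ k ∧ k < i),
        ((u k : ℝ) + 1 - θ k)) * (x i - θ i) =
      ((u j : ℝ) + 1 - θ j) * tail u θ (j + 1) x := by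
    rw [tail, Finset.mul_sum]
    refine Finset.sum_congr rfl fun i hi => ?_
    simp only [Finset.mem_filter, Finset.mem_univ, true_and] at hi
    have h2 : Finset.univ.filter (fun k : Fin n => 1 ≤ θ k ∧ (j : ℕ) ≤ k ∧ k < i) =
        insert j (Finset.univ.filter
          (fun k : Fin n => 1 ≤ θ k ∧ (j : ℕ) + 1 ≤ k ∧ k < i)) := by
      ext k
      simp only [Finset.mem_filter, Finset.mem_univ, true_and, Finset.mem_insert, Fin.lt_def]
      by_cases hk : k = j
      · subst hk
        simp only [hj, true_and, true_or, iff_true]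
        omega
      · have : (k : ℕ) ≠ j := fun e => hk (Fin.ext e)
        simp only [hk, false_or]
        constructor <;> rintro ⟨h1, h2⟩ <;> exact ⟨h1, by omega⟩
    rw [h2, Finset.prod_insert (by simp)]
    ring
  rw [tail, h, Finset.sum_insert (by simp), h1, h0, excess]
  simp only [Finset.prod_empty]
  ring

theorem tail_of_not_support {u θ : Fin n → ℤ} {j : Fin n} (hj : ¬ 1 ≤ θ j) (x : Fin n → ℝ) :
    tail u θ j x = tail u θ (j + 1) x := by
  have key : ∀ k : Fin n, 1 ≤ θ k → ((j : ℕ) ≤ k ↔ (j : ℕ) + 1 ≤ k) := by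
    intro k hk
    have : (k : ℕ) ≠ j := fun e => hj (Fin.ext e ▸ hk)
    omega
  unfold tail
  rw [Finset.filter_congr (fun i _ => and_congr_right (key i))]
  refine Finset.sum_congr rfl fun i _ => ?_
  rw [Finset.filter_congr
    (fun k _ => and_congr_right fun hk => and_congr_left fun _ => key k hk)]

theorem tail_eq_zero {u θ : Fin n → ℤ} {m : ℕ} {x : Fin n → ℝ}
    (h : ∀ i : Fin n, m ≤ i → x i = θ i) : tail u θ m x = 0 :=
  Finset.sum_eq_zero fun i hi => by
    rw [h i (Finset.mem_filter.1 hi).2.2, sub_self, mul_zero]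

theorem tail_affine (u θ : Fin n → ℤ) (m : ℕ) {x y z : Fin n → ℝ} {s : ℝ}
    (h : ∀ i, x i = s * y i + (1 - s) * z i) :
    tail u θ m x = s * tail u θ m y + (1 - s) * tail u θ m z := by
  simp only [tail, Finset.mul_sum, ← Finset.sum_add_distrib]
  refine Finset.sum_congr rfl fun i _ => ?_
  rw [h i]
  ring

theorem excess_affine (u θ : Fin n → ℤ) (j : Fin n) {x y z : Fin n → ℝ} {s : ℝ}
    (h : ∀ i, x i = s * y i + (1 - s) * z i) :
    excess u θ j x = s * excess u θ j y + (1 - s) * excess u θ j z := by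
  simp only [excess, tail_affine u θ _ h, h j]
  ring

theorem sum_phi_eq (u θ : Fin n → ℤ) (j : Fin n) (x : Fin n → ℝ) :
    ∑ i ∈ supportAbove θ j, (phi u θ j i : ℝ) * (x i - (θ i : ℝ)) =
      ((u j : ℝ) - θ j) * tail u θ (j + 1) x := by
  have h1 : supportAbove θ j =
      Finset.univ.filter (fun i : Fin n => 1 ≤ θ i ∧ (j : ℕ) + 1 ≤ i) := by
    ext i
    simp [supportAbove, support]
  rw [h1, tail, Finset.mul_sum]
  refine Finset.sum_congr rfl fun i _ => ?_
  have h2 : (support θ).filter (fun k => j < k ∧ k < i) =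
      Finset.univ.filter (fun k : Fin n => 1 ≤ θ k ∧ (j : ℕ) + 1 ≤ k ∧ k < i) := by
    ext k
    simp [support]
  rw [phi, h2]
  push_cast
  ring

theorem inequality_iff_excess_nonpos (u θ : Fin n → ℤ) (j : Fin n) (x : Fin n → ℝ) :
    x j + ∑ i ∈ supportAbove θ j, (phi u θ j i : ℝ) * (x i - (θ i : ℝ)) ≤ (θ j : ℝ) ↔
      excess u θ j x ≤ 0 := by
  rw [sum_phi_eq, excess]
  constructor <;> intro h <;> linarith

/-! ### Validity of the inequalities -/

/-- The polyhedron cut out of the box by the inequalities `excess u θ j x ≤ 0`. -/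
def packing (u θ : Fin n → ℤ) : Set (Fin n → ℝ) :=
  {x | (∀ i, 0 ≤ x i ∧ x i ≤ (u i : ℝ)) ∧ ∀ j, excess u θ j x ≤ 0}

theorem convex_packing (u θ : Fin n → ℤ) : Convex ℝ (packing u θ) := by
  intro x hx y hy s t hs ht hst
  obtain rfl : t = 1 - s := by linarith
  have h : ∀ i, (s • x + (1 - s) • y) i = s * x i + (1 - s) * y i := fun i => by simp
  refine ⟨fun i => ?_, fun j => ?_⟩
  · rw [h i]
    constructor
    · have := mul_nonneg hs (hx.1 i).1
      have := mul_nonneg ht (hy.1 i).1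
      linarith
    · have := mul_le_mul_of_nonneg_left (hx.1 i).2 hs
      have := mul_le_mul_of_nonneg_left (hy.1 i).2 ht
      linarith
  · rw [excess_affine u θ j h]
    have := mul_nonpos_of_nonneg_of_nonpos hs (hx.2 j)
    have := mul_nonpos_of_nonneg_of_nonpos ht (hy.2 j)
    linarith

theorem excess_nonpos_of_tail_le_neg_one {u θ : Fin n → ℤ} {j : Fin n} {x : Fin n → ℝ}
    (hθu : θ j ≤ u j) (hx : x j ≤ u j) (h : tail u θ (j + 1) x ≤ -1) :
    excess u θ j x ≤ 0 := by
  have h1 : (0 : ℝ) ≤ (u j : ℝ) - θ j := sub_nonneg.2 (by exact_mod_cast hθu)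
  have := mul_le_mul_of_nonneg_left h h1
  rw [excess]
  linarith

theorem cast_knapsack_mem_packing {a u : Fin n → ℤ} {b : ℤ} (ha : ∀ i, 0 < a i)
    {x : Fin n → ℤ} (hx : x ∈ knapsack a u b) :
    (fun i => (x i : ℝ)) ∈ packing u (greedy a u b) := by
  set θ := greedy a u b with hθ
  set y : Fin n → ℝ := fun i => (x i : ℝ) with hy
  have hxu : ∀ i, y i ≤ u i := fun i => Int.cast_le.2 (hx.1 i).2
  have hθu : ∀ i, θ i ≤ u i := greedy_le a u b
  have hex : ∀ j : Fin n, (tail u θ (j + 1) y ≤ -1 ∨ ∀ i : Fin n, (j : ℕ) + 1 ≤ i → x i = θ i) →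
      excess u θ j y ≤ 0 := by
    rintro j (h | h)
    · exact excess_nonpos_of_tail_le_neg_one (hθu j) (hxu j) h
    · rw [excess, tail_eq_zero (fun i hi => by simp only [hy, h i hi])]
      have h1 : x j ≤ θ j := le_greedy_of_eq_above ha hx fun i hi => h i hi
      have h2 : y j ≤ θ j := Int.cast_le.2 h1
      linarith
  -- Once the tail is at most `-1` it stays so, since each step adds a nonpositive excess or
  -- nothing.
  have main : ∀ m ≤ n, tail u θ m y ≤ -1 ∨ ∀ i : Fin n, m ≤ i → x i = θ i := by
    apply downward_induction
    · exact Or.inr fun i hi => absurd i.isLt (by omega)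
    · intro j ih
      have hj := hex j ih
      rcases ih with h | h
      · left
        by_cases hI : 1 ≤ θ j
        · rw [tail_of_support hI]
          linarith
        · rwa [tail_of_not_support hI]
      · have h1 : x j ≤ θ j := le_greedy_of_eq_above ha hx fun i hi => h i hi
        rcases h1.eq_or_lt with h2 | h2
        · right
          intro i hi
          rcases Nat.eq_or_lt_of_le hi with e | e
          · rw [← Fin.ext e, h2]
          · exact h i e
        · left
          have h3 := (hx.1 j).1
          have hz := tail_eq_zero (u := u) (θ := θ) (m := (j : ℕ) + 1) (x := y)
            (fun i hi => by simp only [hy, h i hi])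
          -- `0 ≤ x j < θ j` puts `j` in the support, so the drop is seen by the tail.
          rw [tail_of_support (by omega), excess, hz]
          have h4 : y j + 1 ≤ θ j := by
            have : ((x j + 1 : ℤ) : ℝ) ≤ θ j := Int.cast_le.2 h2
            simpa [hy] using this
          linarith
  exact ⟨fun i => ⟨Int.cast_nonneg (hx.1 i).1, hxu i⟩, fun j => hex j (main _ j.isLt)⟩

/-! ### Every point of the polyhedron lies in the convex hull -/

/-- Replacing coordinates by `0` preserves the inequalities, as long as the result stays below
the upper bounds. -/
theorem excess_nonpos_of_clip {u θ : Fin n → ℤ} (hθ0 : ∀ i, 0 ≤ θ i) (hθu : ∀ i, θ i ≤ u i)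
    {w z : Fin n → ℝ} (hz : ∀ i, z i = w i ∨ z i = 0) (hzu : ∀ i, z i ≤ u i)
    (hw : ∀ j, excess u θ j w ≤ 0) (j : Fin n) : excess u θ j z ≤ 0 := by
  have hex : ∀ j : Fin n, (tail u θ (j + 1) z ≤ -1 ∨
      (tail u θ (j + 1) z = tail u θ (j + 1) w ∧ tail u θ (j + 1) w ≤ 0)) →
      excess u θ j z ≤ 0 := by
    rintro j (h | ⟨h, h'⟩)
    · exact excess_nonpos_of_tail_le_neg_one (hθu j) (hzu j) h
    · rcases hz j with e | e
      · have := hw j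
        rw [excess] at this ⊢
        rwa [h, e]
      · have h1 : (0 : ℝ) ≤ (u j : ℝ) - θ j := sub_nonneg.2 (by exact_mod_cast hθu j)
        have h2 : (0 : ℝ) ≤ θ j := by exact_mod_cast hθ0 j
        have := mul_nonpos_of_nonneg_of_nonpos h1 h'
        rw [excess, h, e]
        linarith
  -- The tails agree until a coordinate in the support is clipped; there the excess is at most `-θ j
  -- ≤ -1`, and the tail stays at most `-1` from then on.
  have main : ∀ m ≤ n, tail u θ m z ≤ -1 ∨
      (tail u θ m z = tail u θ m w ∧ tail u θ m w ≤ 0) := by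
    apply downward_induction
    · have h0 : ∀ v : Fin n → ℝ, tail u θ n v = 0 := fun v =>
        tail_eq_zero fun i hi => absurd i.isLt (by omega)
      exact Or.inr ⟨by rw [h0, h0], (h0 w).le⟩
    · intro j ih
      have hj := hex j ih
      by_cases hI : 1 ≤ θ j
      · rw [tail_of_support hI, tail_of_support hI]
        rcases ih with h | ⟨h, h'⟩
        · left
          linarith
        · rcases hz j with e | e
          · right
            refine ⟨?_, by linarith [hw j]⟩
            rw [excess, excess, h, e]
          · left
            have h1 : (0 : ℝ) ≤ (u j : ℝ) - θ j := sub_nonneg.2 (by exact_mod_cast hθu j)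
            have h2 : (1 : ℝ) ≤ θ j := by exact_mod_cast hI
            have := mul_nonpos_of_nonneg_of_nonpos h1 h'
            rw [excess, h, e]
            linarith
      · rwa [tail_of_not_support hI, tail_of_not_support hI]
  exact hex j (main _ j.isLt)

/-- A box is the convex hull of its corners, so only these need to lie in `K`. -/
theorem mem_convexHull_of_mem_integer_box {K : Set (Fin n → ℤ)} {l h : Fin n → ℤ}
    (hK : ∀ x : Fin n → ℤ, (∀ i, x i = l i ∨ x i = h i) → x ∈ K)
    {y : Fin n → ℝ} (hy : ∀ i, (l i : ℝ) ≤ y i ∧ y i ≤ h i) :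
    y ∈ convexHull ℝ ((fun (x : Fin n → ℤ) (i : Fin n) => (x i : ℝ)) '' K) := by
  have h1 : y ∈ convexHull ℝ
      (Set.pi Set.univ fun i => ({(l i : ℝ), (h i : ℝ)} : Set ℝ)) := by
    rw [convexHull_pi]
    intro i _
    beta_reduce
    rw [convexHull_pair, segment_eq_Icc ((hy i).1.trans (hy i).2)]
    exact hy i
  refine convexHull_mono ?_ h1
  intro z hz
  have hz' : ∀ i, ∃ t : ℤ, (t = l i ∨ t = h i) ∧ (t : ℝ) = z i := by
    intro i
    rcases hz i (Set.mem_univ i) with e | e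
    · exact ⟨l i, Or.inl rfl, e.symm⟩
    · exact ⟨h i, Or.inr rfl, (Set.mem_singleton_iff.1 e).symm⟩
  choose t ht ht' using hz'
  exact ⟨t, hK t ht, funext ht'⟩

/-- The real points of the box that agree with the greedy solution above `m` and are at least
`1` below it at `m` lie in the convex hull of the knapsack. -/
theorem mem_knapsackPolytope_of_lt_greedy {a u : Fin n → ℤ} {b : ℤ} (ha : ∀ i, 0 < a i)
    (hu : ∀ i, 0 < u i) (hb : 0 < b) (hsup : WeaklySuperincreasing a u)
    {y : Fin n → ℝ} (hy : ∀ i, 0 ≤ y i ∧ y i ≤ u i) {m : Fin n}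
    (h : ∀ i, m < i → y i = greedy a u b i) (hm : y m ≤ greedy a u b m - 1) :
    y ∈ knapsackPolytope a u b := by
  set θ := greedy a u b with hθ
  have hθ0 : ∀ i, 0 ≤ θ i := greedy_nonneg a u b ha hu hb
  have hθu : ∀ i, θ i ≤ u i := greedy_le a u b
  have hθm : 1 ≤ θ m := by
    have : (1 : ℝ) ≤ θ m := by linarith [(hy m).1]
    exact_mod_cast this
  refine mem_convexHull_of_mem_integer_box
    (l := fun i => if m < i then θ i else 0)
    (h := fun i => if m < i then θ i else if i = m then θ m - 1 else u i) ?_ ?_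
  · intro x hx
    refine mem_knapsack_of_lt_greedy ha hb hsup (j := m) ?_ ?_ ?_
    · intro i
      have := hx i
      have := hθ0 i
      have := hθu i
      have := hu i
      by_cases h1 : m < i
      · simp_all
      · by_cases h2 : i = m
        · subst h2
          simp only [h1, if_false, if_true] at *
          omega
        · simp only [h1, h2, if_false] at *
          omega
    · intro i hi
      simpa [hi] using hx i
    · have := hx m
      simp only [lt_irrefl, if_false, if_true] at this
      change x m ≤ θ m - 1
      omega
  · intro i
    by_cases h1 : m < i
    · simp [h1, h i h1]
    · by_cases h2 : i = m
      · subst h2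
        simpa using ⟨(hy i).1, hm⟩
      · simpa [h1, h2] using hy i

/-- A point of the packing polyhedron that agrees with `θ` above `m` and is less than `1` below it
at `m` is a convex combination of a point of the box below `θ` and a point of the polyhedron that
agrees with `θ` from `m` on. -/
theorem exists_decomposition_of_mem_packing {u θ : Fin n → ℤ} (hθ0 : ∀ i, 0 ≤ θ i)
    (hθu : ∀ i, θ i ≤ u i) {x : Fin n → ℝ} (hx : x ∈ packing u θ) {m : Fin n}
    (h : ∀ i, m < i → x i = θ i) {s : ℝ} (hs0 : 0 < s) (hs1 : s < 1) (hxm : x m = θ m - s)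
    (hθm : 1 ≤ θ m) :
    ∃ y z : Fin n → ℝ, (∀ i, x i = s * y i + (1 - s) * z i) ∧
      (∀ i, 0 ≤ y i ∧ y i ≤ u i) ∧ (∀ i, m < i → y i = θ i) ∧ y m = θ m - 1 ∧
      z ∈ packing u θ ∧ ∀ i, m ≤ i → z i = θ i := by
  have ht : 0 < 1 - s := by linarith
  have hθ0' : ∀ i, (0 : ℝ) ≤ θ i := fun i => by exact_mod_cast hθ0 i
  have hθu' : ∀ i, (θ i : ℝ) ≤ u i := fun i => by exact_mod_cast hθu i
  have hθm' : (1 : ℝ) ≤ θ m := by exact_mod_cast hθm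
  -- the maximal point below `θ` at `m`, on which all the inequalities below `m` are tight
  let v : Fin n → ℝ := fun i => if i < m then u i else if i = m then θ m - 1 else θ i
  -- `w` solves `x = s * v + (1 - s) * w` but may have negative entries; `z` clips them at `0`, and
  -- `y` compensates.
  let w : Fin n → ℝ := fun i => if i < m then (x i - s * u i) / (1 - s) else θ i
  let z : Fin n → ℝ := fun i => if i < m then max 0 (w i) else θ i
  let y : Fin n → ℝ := fun i => if i < m then (x i - (1 - s) * z i) / s else
    if i = m then θ m - 1 else θ i
  have hwlt : ∀ i, i < m → (1 - s) * w i = x i - s * u i := by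
    intro i hi
    simp only [w, hi, if_true]
    field_simp
  have hwge : ∀ i, m ≤ i → w i = θ i := fun i hi => by simp [w, not_lt.2 hi]
  have hzlt : ∀ i, i < m → z i = max 0 (w i) := fun i hi => by simp [z, hi]
  have hzge : ∀ i, m ≤ i → z i = θ i := fun i hi => by simp [z, not_lt.2 hi]
  have hylt : ∀ i, i < m → s * y i = x i - (1 - s) * z i := by
    intro i hi
    simp only [y, hi, if_true]
    field_simp
  have hym : y m = θ m - 1 := by simp [y]
  have hygt : ∀ i, m < i → y i = θ i := fun i hi => by simp [y, not_lt.2 hi.le, hi.ne']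
  have hvm : v m = θ m - 1 := by simp [v]
  have hvgt : ∀ i, m < i → v i = θ i := fun i hi => by simp [v, not_lt.2 hi.le, hi.ne']
  have hvlt : ∀ i, i < m → v i = u i := fun i hi => by simp [v, hi]
  have hzu : ∀ i, z i ≤ u i := by
    intro i
    rcases lt_or_ge i m with hi | hi
    · rw [hzlt i hi]
      refine max_le ((hθ0' i).trans (hθu' i)) ?_
      refine le_of_mul_le_mul_left ?_ ht
      rw [hwlt i hi]
      linarith [(hx.1 i).2]
    · rw [hzge i hi]
      exact hθu' i
  have hxvw : ∀ i, x i = s * v i + (1 - s) * w i := by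
    intro i
    rcases lt_trichotomy i m with hi | hi | hi
    · rw [hwlt i hi, hvlt i hi]
      ring
    · subst hi
      rw [hvm, hwge i le_rfl, hxm]
      ring
    · rw [hvgt i hi, hwge i hi.le, h i hi]
      ring
  -- The drop at `m` makes the tail `-1`; below `m`, `v i = u i` then gives excess `0`, so the tail
  -- never changes.
  have htail : ∀ k ≤ (m : ℕ), tail u θ k v = -1 := by
    intro k hk
    refine Nat.decreasingInduction (motive := fun k _ => tail u θ k v = -1) ?_ ?_ hk
    · intro k hk ih
      have hkm : (⟨k, hk.trans m.isLt⟩ : Fin n) < m := hk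
      set j : Fin n := ⟨k, hk.trans m.isLt⟩ with hj
      change tail u θ (j : ℕ) v = -1
      change tail u θ ((j : ℕ) + 1) v = -1 at ih
      by_cases hI : 1 ≤ θ j
      · rw [tail_of_support hI, excess, ih, hvlt j hkm]
        ring
      · rw [tail_of_not_support hI, ih]
    · rw [tail_of_support hθm, excess, hvm, tail_eq_zero (fun i hi => hvgt i hi)]
      ring
  have hw : ∀ j, excess u θ j w ≤ 0 := by
    intro j
    rcases lt_or_ge j m with hj | hj
    · have h1 := hx.2 j
      have h2 : excess u θ j v = 0 := by
        rw [excess, htail _ hj, hvlt j hj]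
        ring
      rw [excess_affine u θ j hxvw, h2, mul_zero, zero_add] at h1
      exact nonpos_of_mul_nonpos_right h1 ht
    · rw [excess, hwge j hj, tail_eq_zero (fun i hi => hwge i (hj.trans (Nat.le_of_succ_le hi)))]
      simp
  have hzw : ∀ i, z i = w i ∨ z i = 0 := by
    intro i
    rcases lt_or_ge i m with hi | hi
    · rw [hzlt i hi]
      exact (max_choice 0 (w i)).symm
    · exact Or.inl (by rw [hzge i hi, hwge i hi])
  refine ⟨y, z, ?_, ?_, hygt, hym, ⟨fun i => ⟨?_, hzu i⟩,
    excess_nonpos_of_clip hθ0 hθu hzw hzu hw⟩, hzge⟩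
  · intro i
    rcases lt_trichotomy i m with hi | hi | hi
    · rw [hylt i hi]
      ring
    · subst hi
      rw [hym, hzge i le_rfl, hxm]
      ring
    · rw [hygt i hi, hzge i hi.le, h i hi]
      ring
  · intro i
    rcases lt_trichotomy i m with hi | hi | hi
    · have h1 := hylt i hi
      have h2 := hwlt i hi
      -- Hence `s * y i = min (x i) (s * u i)`, which lies between `0` and `s * u i`.
      have h3 : (1 - s) * z i = max 0 (x i - s * u i) := by
        rw [hzlt i hi, mul_max_of_nonneg _ _ ht.le, mul_zero, h2]
      have hxi := hx.1 i
      have h4 : 0 ≤ s * u i := mul_nonneg hs0.le (hxi.1.trans hxi.2)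
      constructor
      · refine le_of_mul_le_mul_left ?_ hs0
        rw [h1, h3, mul_zero, sub_nonneg]
        exact max_le hxi.1 (by linarith)
      · refine le_of_mul_le_mul_left ?_ hs0
        rw [h1, h3]
        linarith [le_max_right 0 (x i - s * u i)]
    · subst hi
      rw [hym]
      constructor <;> linarith [hθu' i]
    · rw [hygt i hi]
      exact ⟨hθ0' i, hθu' i⟩
  · rcases lt_or_ge i m with hi | hi
    · rw [hzlt i hi]
      exact le_max_left _ _
    · rw [hzge i hi]
      exact hθ0' i

theorem packing_subset_knapsackPolytope {a u : Fin n → ℤ} {b : ℤ} (ha : ∀ i, 0 < a i)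
    (hu : ∀ i, 0 < u i) (hb : 0 < b) (hsup : WeaklySuperincreasing a u) :
    packing u (greedy a u b) ⊆ knapsackPolytope a u b := by
  set θ := greedy a u b with hθ
  have hθ0 : ∀ i, 0 ≤ θ i := greedy_nonneg a u b ha hu hb
  have hθu : ∀ i, θ i ≤ u i := greedy_le a u b
  have main : ∀ m ≤ n, ∀ x ∈ packing u θ, (∀ i : Fin n, m ≤ i → x i = θ i) →
      x ∈ knapsackPolytope a u b := by
    intro m
    induction m with
    | zero =>
      intro _ x _ h
      exact subset_convexHull ℝ _ ⟨θ, greedy_mem_knapsack a u b ha hu hb,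
        funext fun i => (h i (Nat.zero_le _)).symm⟩
    | succ k ih =>
      intro hk x hx h
      let m : Fin n := ⟨k, hk⟩
      have hgt : ∀ i, m < i → x i = θ i := fun i hi => h i hi
      have hxm : x m ≤ θ m := by
        have := hx.2 m
        rw [excess, tail_eq_zero (fun i hi => h i hi)] at this
        linarith
      rcases hxm.eq_or_lt with e | hlt
      · refine ih (by omega) x hx fun i hi => ?_
        rcases Nat.eq_or_lt_of_le hi with e' | e'
        · obtain rfl : m = i := Fin.ext e'
          exact e
        · exact h i e'
      · rcases le_or_gt (x m) (θ m - 1) with h1 | h1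
        · exact mem_knapsackPolytope_of_lt_greedy ha hu hb hsup hx.1 hgt h1
        · have hθm : 1 ≤ θ m := by
            have : (0 : ℝ) < θ m := (hx.1 m).1.trans_lt hlt
            have : 0 < θ m := by exact_mod_cast this
            omega
          -- The weight is forced by `y m = θ m - 1` and `z m = θ m`.
          obtain ⟨y, z, hxyz, hy, hygt, hym, hz, hzge⟩ :=
            exists_decomposition_of_mem_packing hθ0 hθu hx hgt (s := θ m - x m)
              (by linarith) (by linarith) (by ring) hθm
          have hyK : y ∈ knapsackPolytope a u b :=
            mem_knapsackPolytope_of_lt_greedy ha hu hb hsup hy hygt hym.le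
          have hzK : z ∈ knapsackPolytope a u b :=
            ih (by omega) z hz fun i hi => hzge i hi
          have hx' : x = ((θ m : ℝ) - x m) • y + (1 - ((θ m : ℝ) - x m)) • z :=
            funext fun i => by simpa using hxyz i
          rw [hx']
          exact convex_convexHull ℝ _ hyK hzK (by linarith) (by linarith) (by ring)
  exact fun x hx => main n le_rfl x hx fun i hi => absurd i.isLt (by omega)

theorem knapsackPolytope_eq_packing {a u : Fin n → ℤ} {b : ℤ} (ha : ∀ i, 0 < a i)
    (hu : ∀ i, 0 < u i) (hb : 0 < b) (hsup : WeaklySuperincreasing a u) :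
    knapsackPolytope a u b = packing u (greedy a u b) := by
  refine Set.Subset.antisymm (convexHull_min ?_ (convex_packing _ _))
    (packing_subset_knapsackPolytope ha hu hb hsup)
  rintro _ ⟨x, hx, rfl⟩
  exact cast_knapsack_mem_packing ha hx

/-! ### Counting the inequalities -/

/-- A system of `n` lower bounds, `n` upper bounds and `n` further inequalities is a system of
`3 * n` linear inequalities. -/
theorem exists_matrix_of_box_and_inequalities (u θ : Fin n → ℝ) (s : Fin n → Finset (Fin n))
    (c : Fin n → Fin n → ℝ) :
    ∃ (A : Matrix (Fin (3 * n)) (Fin n) ℝ) (d : Fin (3 * n) → ℝ),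
      {x : Fin n → ℝ | (∀ i, 0 ≤ x i ∧ x i ≤ u i) ∧
        ∀ j, x j + ∑ i ∈ s j, c j i * (x i - θ i) ≤ θ j} =
      {x : Fin n → ℝ | ∀ r, ∑ i, A r i * x i ≤ d r} := by
  let B : Fin 3 → Fin n → Fin n → ℝ := ![fun j i => if i = j then -1 else 0,
    fun j i => if i = j then 1 else 0,
    fun j i => (if i = j then 1 else 0) + if i ∈ s j then c j i else 0]
  let e : Fin 3 → Fin n → ℝ := ![fun _ => 0, u, fun j => θ j + ∑ i ∈ s j, c j i * θ i]
  refine ⟨Matrix.of fun r => B (finProdFinEquiv.symm r).1 (finProdFinEquiv.symm r).2,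
    fun r => e (finProdFinEquiv.symm r).1 (finProdFinEquiv.symm r).2, ?_⟩
  ext x
  have key : (∀ r : Fin (3 * n), ∑ i, Matrix.of (fun r : Fin (3 * n) =>
      B (finProdFinEquiv.symm r).1 (finProdFinEquiv.symm r).2) r i * x i ≤
        e (finProdFinEquiv.symm r).1 (finProdFinEquiv.symm r).2) ↔
      ∀ t j, ∑ i, B t j i * x i ≤ e t j := by
    constructor
    · intro h t j
      simpa only [Equiv.symm_apply_apply, Matrix.of_apply] using h (finProdFinEquiv (t, j))
    · intro h r
      exact h _ _
  have h2 : ∀ j, ∑ i, B 2 j i * x i = x j + ∑ i ∈ s j, c j i * x i := by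
    intro j
    simp [B, add_mul, Finset.sum_add_distrib, ite_mul, Finset.sum_ite_mem]
  rw [Set.mem_ofPred_eq, Set.mem_ofPred_eq, key, Fin.forall_fin_succ, Fin.forall_fin_two]
  have h2' : ∀ j, ∑ i, B (Fin.succ 1) j i * x i = x j + ∑ i ∈ s j, c j i * x i := h2
  simp only [h2']
  simp only [B, e, mul_sub, Finset.sum_sub_distrib, forall_and]
  simp [ite_mul, and_assoc, ← add_sub_assoc]

end SuperincreasingKnapsack

theorem theorem1 (n : ℕ) (a u : Fin n → ℤ) (b : ℤ)
    (ha : ∀ i, 0 < a i) (hu : ∀ i, 0 < u i) (hb : 0 < b)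
    (hsup : SuperincreasingKnapsack.WeaklySuperincreasing a u)
    (θ : Fin n → ℤ) (hθ : θ = SuperincreasingKnapsack.greedy a u b) :
    SuperincreasingKnapsack.knapsackPolytope a u b =
        {x : Fin n → ℝ | (∀ i, 0 ≤ x i ∧ x i ≤ (u i : ℝ)) ∧
          ∀ j, x j + ∑ i ∈ SuperincreasingKnapsack.supportAbove θ j,
            (SuperincreasingKnapsack.phi u θ j i : ℝ) * (x i - (θ i : ℝ)) ≤ (θ j : ℝ)} ∧
      ∃ (A : Matrix (Fin (3 * n)) (Fin n) ℝ) (c : Fin (3 * n) → ℝ),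
        SuperincreasingKnapsack.knapsackPolytope a u b =
          {x : Fin n → ℝ | ∀ r, ∑ i, A r i * x i ≤ c r} := by
  have h : SuperincreasingKnapsack.knapsackPolytope a u b =
        {x : Fin n → ℝ | (∀ i, 0 ≤ x i ∧ x i ≤ (u i : ℝ)) ∧
          ∀ j, x j + ∑ i ∈ SuperincreasingKnapsack.supportAbove θ j,
            (SuperincreasingKnapsack.phi u θ j i : ℝ) * (x i - (θ i : ℝ)) ≤ (θ j : ℝ)} := by
    subst hθ
    rw [SuperincreasingKnapsack.knapsackPolytope_eq_packing ha hu hb hsup]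
    simp only [SuperincreasingKnapsack.inequality_iff_excess_nonpos]
    rfl
  refine ⟨h, ?_⟩
  rw [h]
  exact SuperincreasingKnapsack.exists_matrix_of_box_and_inequalities (fun i => (u i : ℝ))
    (fun i => (θ i : ℝ)) (SuperincreasingKnapsack.supportAbove θ)
    (fun j i => (SuperincreasingKnapsack.phi u θ j i : ℝ))
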